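/- Let $M$ be a complex manifold of complex dimension $n$ with complex structure $J$, and let $g$ be a Hermitian metric on $M$, that is, a smooth Riemannian metric with $g(Ju,Jv)=g(u,v)$ for all tangent vectors $u,v$ at the same point. Let $\nabla$ be the Riemannian (Levi-Civita) connection of $g$, i.e. the torsion-free connection on $TM$ with $\nabla g=0$, and let $\nabla^h$ be its Hermitian (Chern) connection, i.e. the connection on $TM$ compatible with the metric and with the holomorphic structure: $\nabla^h g=0$, $\nabla^h J=0$, and $\nabla^h_{Ju}Z=J\nabla^h_uZ$ for every local holomorphic vector field $Z$ and every tangent vector $u$. Let $R$ and $R^h$ be the curvature tensors of $\nabla$ and $\nabla^h$, where the curvature of a connection $D$ on $TM$ is $R^D(X,Y)Z=D_XD_YZ-D_YD_XZ-D_{[X,Y]}Z$. If $R=R^h$ on $M$, then $g$ is Kähler: the fundamental form $\omega(u,v)=g(Ju,v)$ satisfies $d\omega=0$, and $\nabla=\nabla^h$. -/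

import Mathlib

set_option linter.unusedSectionVars false
set_option linter.unusedSimpArgs false

open scoped Manifold ContDiff Bundle Topology
open Bundle

namespace HermitianGeometry

section ComplexStructure

variable {E : Type*} [NormedAddCommGroup E] [NormedSpace ℂ E]
  {M : Type*} [TopologicalSpace M] [ChartedSpace E M]

/-- A holomorphic atlas is in particular a real-analytic one. -/
instance isManifold_real [IsManifold 𝓘(ℂ, E) ω M] : IsManifold 𝓘(ℝ, E) ω M := by
  refine isManifold_of_contDiffOn _ _ _ fun e e' he he' ↦ ?_
  exact ((contDiffGroupoid ω 𝓘(ℂ, E)).compatible he he').1.restrict_scalars ℝ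

variable (E M) in
/-- Real vector fields on `M`, with no regularity. -/
abbrev VField : Type _ := Π x : M, TangentSpace 𝓘(ℝ, E) x

/-- The almost complex structure of `M`: multiplication by `i` on the tangent spaces. Tangent
vectors at `x` are read in the preferred chart at `x`; transition maps being holomorphic, any other
chart of the atlas gives the same operator. -/
noncomputable def J (x : M) : TangentSpace 𝓘(ℝ, E) x →L[ℝ] TangentSpace 𝓘(ℝ, E) x :=
  (Complex.I • ContinuousLinearMap.id ℝ E : E →L[ℝ] E)

theorem J_J (x : M) (v : TangentSpace 𝓘(ℝ, E) x) : J x (J x v) = -v := by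
  change Complex.I • Complex.I • (show E from v) = -(show E from v)
  rw [smul_smul, Complex.I_mul_I, neg_one_smul]

variable [IsManifold 𝓘(ℂ, E) ω M]

/-- The vector field `Z` is (real) differentiable at `x`. -/
def IsDiffAt (Z : VField E M) (x : M) : Prop :=
  MDifferentiableAt 𝓘(ℝ, E) (𝓘(ℝ, E).prod 𝓘(ℝ, E)) (fun y ↦ TotalSpace.mk' E y (Z y)) x

/-- The vector field `Z` is smooth at `x`. -/
def IsSmoothAt (Z : VField E M) (x : M) : Prop :=
  ContMDiffAt 𝓘(ℝ, E) (𝓘(ℝ, E).prod 𝓘(ℝ, E)) ∞ (fun y ↦ TotalSpace.mk' E y (Z y)) x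

/-- The vector field `Z` is holomorphic near `x`, as a section of the holomorphic tangent bundle
(identified with the real tangent bundle equipped with `J`). -/
def IsHolomorphicAt (Z : VField E M) (x : M) : Prop :=
  ∀ᶠ y in 𝓝 x, MDifferentiableAt 𝓘(ℂ, E) (𝓘(ℂ, E).prod 𝓘(ℂ, E))
    (fun z ↦ (TotalSpace.mk' E z (Z z) : TangentBundle 𝓘(ℂ, E) M)) y

/-- Real and complex trivializations of the tangent bundle agree. -/
theorem trivialization_real_complex {x y : M} (hy : y ∈ (chartAt E x).source) (v : E) :
    (trivializationAt E (TangentSpace 𝓘(ℝ, E)) x (⟨y, v⟩ : TangentBundle 𝓘(ℝ, E) M)).2 =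
    (trivializationAt E (TangentSpace 𝓘(ℂ, E)) x (⟨y, v⟩ : TangentBundle 𝓘(ℂ, E) M)).2 := by
  have h := hasFDerivWithinAt_tangentCoordChange (I := 𝓘(ℂ, E)) (x := y) (y := x) (z := y)
    ⟨by simp, by simpa using hy⟩
  have h1 := (h.restrictScalars ℝ).fderivWithin (by simp)
  exact congrArg (fun L : E →L[ℝ] E => L v) h1

theorem trivialization_J {x y : M} (hy : y ∈ (chartAt E x).source)
    (v : TangentSpace 𝓘(ℝ, E) y) :
    (trivializationAt E (TangentSpace 𝓘(ℝ, E)) x (⟨y, J y v⟩ : TangentBundle 𝓘(ℝ, E) M)).2 =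
    Complex.I •
    (trivializationAt E (TangentSpace 𝓘(ℝ, E)) x (⟨y, v⟩ : TangentBundle 𝓘(ℝ, E) M)).2 := by
  have h1 := trivialization_real_complex hy v
  have h2 := trivialization_real_complex hy (J y v)
  rw [h1, h2]
  exact ContinuousLinearMap.map_smul (tangentCoordChange 𝓘(ℂ, E) y x y) Complex.I (show E from v)

/-- The vector field `Z` read in the chart at `x`. -/
noncomputable def rep (Z : VField E M) (x : M) : M → E := fun y ↦
  (trivializationAt E (TangentSpace 𝓘(ℝ, E)) x (⟨y, Z y⟩ : TangentBundle 𝓘(ℝ, E) M)).2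

theorem rep_self (Z : VField E M) (x : M) : rep Z x x = Z x :=
  tangentCoordChange_self (I := 𝓘(ℝ, E)) (x := x) (z := x) (v := Z x) (by simp)

theorem isDiffAt_iff (Z : VField E M) (x : M) :
    IsDiffAt Z x ↔ MDifferentiableAt 𝓘(ℝ, E) 𝓘(ℝ, E) (rep Z x) x :=
  mdifferentiableAt_section 𝓘(ℝ, E) Z

theorem source_mem (x : M) : (chartAt E x).source ∈ 𝓝 x :=
  (chartAt E x).open_source.mem_nhds (mem_chart_source E x)

theorem rep_add (Z W : VField E M) (x : M) : rep (Z + W) x =ᶠ[𝓝 x] rep Z x + rep W x := by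
  filter_upwards [source_mem (E := E) x] with y hy
  exact ((trivializationAt E (TangentSpace 𝓘(ℝ, E)) x).linear ℝ (b := y) hy).map_add (Z y) (W y)

theorem rep_smul (f : M → ℝ) (Z : VField E M) (x : M) : rep (f • Z) x =ᶠ[𝓝 x] f • rep Z x := by
  filter_upwards [source_mem (E := E) x] with y hy
  exact ((trivializationAt E (TangentSpace 𝓘(ℝ, E)) x).linear ℝ (b := y) hy).map_smul (f y) (Z y)

theorem rep_J (Z : VField E M) (x : M) :
    rep (fun y ↦ J y (Z y)) x =ᶠ[𝓝 x]
      ((Complex.I • ContinuousLinearMap.id ℝ E : E →L[ℝ] E) ∘ rep Z x) := by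
  filter_upwards [source_mem (E := E) x] with y hy
  exact trivialization_J hy (Z y)

theorem mvfderiv_congr {f f' : M → E} {x : M} (h : f =ᶠ[𝓝 x] f') :
    mvfderiv 𝓘(ℝ, E) f x = mvfderiv 𝓘(ℝ, E) f' x := by
  ext v
  have := h.mfderiv_eq (I := 𝓘(ℝ, E)) (I' := 𝓘(ℝ, E))
  exact congrArg (fun L : E →L[ℝ] E ↦ L v) this

/-- The covariant derivative which, at each point `x`, is the flat one of the chart at `x`. -/
noncomputable def chartCov :
    CovariantDerivative 𝓘(ℝ, E) E (fun x : M ↦ TangentSpace 𝓘(ℝ, E) x) where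
  toFun Z x := mvfderiv 𝓘(ℝ, E) (rep Z x) x
  isCovariantDerivativeOnUniv :=
    { add := by
        intro Z W x hZ hW _
        have hZ := (isDiffAt_iff Z x).1 hZ
        have hW := (isDiffAt_iff W x).1 hW
        exact (mvfderiv_congr (rep_add Z W x)).trans (mvfderiv_add hZ hW)
      leibniz := by
        intro Z f x hZ hf _
        have hZ := (isDiffAt_iff Z x).1 hZ
        refine (mvfderiv_congr (rep_smul f Z x)).trans ((mvfderiv_smul hf hZ).trans ?_)
        rw [rep_self]
        rfl }

theorem chartCov_J {Z : VField E M} {x : M} (hZ : IsDiffAt Z x) (u : TangentSpace 𝓘(ℝ, E) x) :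
    chartCov (fun y ↦ J y (Z y)) x u = J x (chartCov Z x u) := by
  have hZ := (isDiffAt_iff Z x).1 hZ
  have h1 := mvfderiv_congr (rep_J Z x)
  have h2 := ((Complex.I • ContinuousLinearMap.id ℝ E : E →L[ℝ] E).hasMFDerivAt (x := rep Z x x)).comp
    x hZ.hasMFDerivAt
  have h3 := h2.mfderiv
  have h4 : mvfderiv 𝓘(ℝ, E) (rep (fun y ↦ J y (Z y)) x) x u = J x (chartCov Z x u) := by
    rw [h1]
    exact congrArg (fun L : E →L[ℝ] E ↦ L u) h3
  exact h4

theorem IsDiffAt.J {Z : VField E M} {x : M} (hZ : IsDiffAt Z x) :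
    IsDiffAt (fun y ↦ J y (Z y)) x := by
  rw [isDiffAt_iff] at *
  have h2 := ((Complex.I • ContinuousLinearMap.id ℝ E : E →L[ℝ] E).hasMFDerivAt (x := rep Z x x)).comp
    x hZ.hasMFDerivAt
  exact h2.mdifferentiableAt.congr_of_eventuallyEq (rep_J Z x)

theorem IsHolomorphicAt.rep {Z : VField E M} {x : M} (hZ : IsHolomorphicAt Z x) :
    MDifferentiableAt 𝓘(ℂ, E) 𝓘(ℂ, E) (rep Z x) x := by
  have h1 := (mdifferentiableAt_section 𝓘(ℂ, E) (E := TangentSpace 𝓘(ℂ, E)) Z).1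
    hZ.self_of_nhds
  refine h1.congr_of_eventuallyEq ?_
  filter_upwards [source_mem (E := E) x] with y hy
  exact trivialization_real_complex hy (Z y)

theorem hasMFDerivAt_real {f : M → E} {x : M} {f' : E →L[ℂ] E}
    (h : HasMFDerivAt 𝓘(ℂ, E) 𝓘(ℂ, E) f x f') :
    HasMFDerivAt 𝓘(ℝ, E) 𝓘(ℝ, E) f x (f'.restrictScalars ℝ) :=
  ⟨h.1, HasFDerivWithinAt.restrictScalars ℝ h.2⟩

theorem IsHolomorphicAt.isDiffAt {Z : VField E M} {x : M} (hZ : IsHolomorphicAt Z x) :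
    IsDiffAt Z x := by
  rw [isDiffAt_iff]
  exact (hasMFDerivAt_real hZ.rep.hasMFDerivAt).mdifferentiableAt

theorem chartCov_holomorphic {Z : VField E M} {x : M} (hZ : IsHolomorphicAt Z x)
    (u : TangentSpace 𝓘(ℝ, E) x) : chartCov Z x (J x u) = J x (chartCov Z x u) := by
  have h1 := (hasMFDerivAt_real hZ.rep.hasMFDerivAt).mfderiv
  have h2 : ∀ v : E, chartCov Z x v = mfderiv 𝓘(ℂ, E) 𝓘(ℂ, E) (HermitianGeometry.rep Z x) x v :=
    fun v ↦ congrArg (fun L : E →L[ℝ] E ↦ L v) h1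
  rw [h2 u]
  exact (h2 _).trans (ContinuousLinearMap.map_smul
    (mfderiv 𝓘(ℂ, E) 𝓘(ℂ, E) (HermitianGeometry.rep Z x) x) Complex.I u)

end ComplexStructure

section Metric

variable {E : Type*} [NormedAddCommGroup E] [NormedSpace ℂ E] [FiniteDimensional ℂ E]
  {M : Type*} [TopologicalSpace M] [ChartedSpace E M] [IsManifold 𝓘(ℂ, E) ω M]

variable (E M) in
/-- Affine connections on the real tangent bundle of `M`. -/
abbrev Connection : Type _ := CovariantDerivative 𝓘(ℝ, E) E (fun x : M ↦ TangentSpace 𝓘(ℝ, E) x)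

variable (E M) in
/-- Smooth Riemannian metrics on `M`. -/
abbrev Metric : Type _ :=
  ContMDiffRiemannianMetric 𝓘(ℝ, E) ∞ E (fun x : M ↦ TangentSpace 𝓘(ℝ, E) x)

/-- The metric is Hermitian: it is preserved by `J`. -/
def IsHermitian (g : Metric E M) : Prop :=
  ∀ (x : M) (u v : TangentSpace 𝓘(ℝ, E) x), g.inner x (J x u) (J x v) = g.inner x u v

/-- `∇ g = 0`, that is, `u (g(Y, Z)) = g(∇_u Y, Z) + g(Y, ∇_u Z)`. Here and below, `cov Z x u` is
`∇_u Z` for a tangent vector `u` at `x`. -/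
def IsMetricCompatible (g : Metric E M) (cov : Connection E M) : Prop :=
  ∀ (x : M) (Y Z : VField E M), IsDiffAt Y x → IsDiffAt Z x → ∀ u : TangentSpace 𝓘(ℝ, E) x,
    mvfderiv 𝓘(ℝ, E) (fun y ↦ g.inner y (Y y) (Z y)) x u =
      g.inner x (cov Y x u) (Z x) + g.inner x (Y x) (cov Z x u)

/-- The Riemannian connection: torsion-free and compatible with the metric. -/
structure IsLeviCivita (g : Metric E M) (cov : Connection E M) : Prop where
  metric : IsMetricCompatible g cov
  torsion : cov.torsion = 0

/-- The Hermitian connection: compatible with the metric and with the holomorphic structure, the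
latter meaning that `∇ J = 0` and `∇^{0,1} = ∂̄`, i.e. `∇_{Ju} Z = J ∇_u Z` whenever `Z` is a local
holomorphic vector field. -/
structure IsChern (g : Metric E M) (cov : Connection E M) : Prop where
  metric : IsMetricCompatible g cov
  map_J : ∀ (x : M) (Z : VField E M), IsDiffAt Z x → ∀ u : TangentSpace 𝓘(ℝ, E) x,
    cov (fun y ↦ J y (Z y)) x u = J x (cov Z x u)
  holomorphic : ∀ (x : M) (Z : VField E M), IsHolomorphicAt Z x →
    ∀ u : TangentSpace 𝓘(ℝ, E) x, cov Z x (J x u) = J x (cov Z x u)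

theorem inner_diff (g : Metric E M) {Y Z : VField E M} {x : M} (hY : IsDiffAt Y x)
    (hZ : IsDiffAt Z x) :
    MDifferentiableAt 𝓘(ℝ, E) 𝓘(ℝ, ℝ) (fun y ↦ g.inner y (Y y) (Z y)) x := by
  have : MDifferentiableAt 𝓘(ℝ, E) (𝓘(ℝ, E).prod 𝓘(ℝ))
      (fun m ↦ TotalSpace.mk' ℝ (E := Bundle.Trivial M ℝ) m (g.inner m (Y m) (Z m))) x := by
    apply MDifferentiableAt.clm_bundle_apply₂ (F₁ := E) (F₂ := E)
    · exact g.contMDiff.mdifferentiableAt (by simp)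
    · exact hY
    · exact hZ
  simp only [mdifferentiableAt_totalSpace] at this
  exact this.2

/-- The covariant derivative of the metric, on vector fields. -/
noncomputable def nablaAux (g : Metric E M) (cov : Connection E M) (Y Z : VField E M) (x : M) :
    TangentSpace 𝓘(ℝ, E) x →L[ℝ] ℝ :=
  mvfderiv 𝓘(ℝ, E) (fun y ↦ g.inner y (Y y) (Z y)) x -
    (g.inner x (Z x)).comp (cov Y x) - (g.inner x (Y x)).comp (cov Z x)

theorem nablaAux_symm (g : Metric E M) (cov : Connection E M) (Y Z : VField E M) (x : M) :
    nablaAux g cov Y Z x = nablaAux g cov Z Y x := by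
  simp only [nablaAux, g.symm _ (Y _) (Z _)]
  exact sub_right_comm _ _ _

theorem nablaAux_tensorial (g : Metric E M) (cov : Connection E M) {Z : VField E M} {x : M}
    (hZ : IsDiffAt Z x) : TensorialAt 𝓘(ℝ, E) E (nablaAux g cov · Z x) x where
  smul := by
    intro f Y hf hY
    ext u
    have h1 : (fun y ↦ g.inner y ((f • Y) y) (Z y)) = f * fun y ↦ g.inner y (Y y) (Z y) := by
      ext y; simp
    have h2 := mvfderiv_mul hf (inner_diff g hY hZ)
    have h3 := cov.isCovariantDerivativeOn.leibniz hY hf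
    simp only [nablaAux, h1, h2, h3]
    simp [g.symm x (Z x)]
    ring
  add := by
    intro Y Y' hY hY'
    ext u
    have h1 : (fun y ↦ g.inner y ((Y + Y') y) (Z y)) =
      (fun y ↦ g.inner y (Y y) (Z y)) + fun y ↦ g.inner y (Y' y) (Z y) := by
      ext y; simp
    have h2 := mvfderiv_add (inner_diff g hY hZ) (inner_diff g hY' hZ)
    have h3 := cov.isCovariantDerivativeOn.add hY hY'
    simp only [nablaAux, h1, h2, h3]
    simp
    ring

/-- Linearity in each of three arguments. -/
structure IsTrilinear {V : Type*} [AddCommGroup V] [Module ℝ V] (F : V → V → V → ℝ) : Prop where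
  left : ∀ u w, IsLinearMap ℝ (F · u w)
  mid : ∀ v w, IsLinearMap ℝ (F v · w)
  right : ∀ v u, IsLinearMap ℝ (F v u)

/-- The covariant derivative of the metric, as a tensor. -/
theorem exists_nabla (g : Metric E M) (cov : Connection E M) (x : M) :
    ∃ N : TangentSpace 𝓘(ℝ, E) x → TangentSpace 𝓘(ℝ, E) x → TangentSpace 𝓘(ℝ, E) x → ℝ,
    IsTrilinear N ∧ (∀ v w u, N v w u = N w v u) ∧
    ∀ Y Z : VField E M, IsDiffAt Y x → IsDiffAt Z x → ∀ u,
      mvfderiv 𝓘(ℝ, E) (fun y ↦ g.inner y (Y y) (Z y)) x u =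
      g.inner x (cov Y x u) (Z x) + g.inner x (Y x) (cov Z x u) + N (Y x) (Z x) u := by
  have h1 : ∀ Z : VField E M, MDifferentiableAt 𝓘(ℝ, E) (𝓘(ℝ, E).prod 𝓘(ℝ, E))
      (fun y ↦ TotalSpace.mk' E y (Z y)) x →
      TensorialAt 𝓘(ℝ, E) E (nablaAux g cov · Z x) x := fun Z hZ ↦ nablaAux_tensorial g cov hZ
  have h2 : ∀ Y : VField E M, MDifferentiableAt 𝓘(ℝ, E) (𝓘(ℝ, E).prod 𝓘(ℝ, E))
      (fun y ↦ TotalSpace.mk' E y (Y y)) x →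
      TensorialAt 𝓘(ℝ, E) E (nablaAux g cov Y · x) x := by
    intro Y hY
    simp only [nablaAux_symm g cov Y]
    exact nablaAux_tensorial g cov hY
  let N := TensorialAt.mkHom₂ (nablaAux g cov · · x) x h1 h2
  refine ⟨fun v w u ↦ N v w u, ⟨fun u w ↦ ⟨fun a b ↦ ?_, fun c a ↦ ?_⟩,
    fun v w ↦ ⟨fun a b ↦ ?_, fun c a ↦ ?_⟩, fun v u ↦ ⟨fun a b ↦ ?_, fun c a ↦ ?_⟩⟩, ?_, ?_⟩
  · rw [N.map_add]; rfl
  · rw [N.map_smul]; rfl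
  · rw [(N v).map_add]; rfl
  · rw [(N v).map_smul]; rfl
  · exact (N v u).map_add a b
  · exact (N v u).map_smul c a
  · intro v w u
    simp only [N]
    rw [TensorialAt.mkHom₂_apply_eq_extend, TensorialAt.mkHom₂_apply_eq_extend, nablaAux_symm]
  · intro Y Z hY hZ u
    simp only [N]
    rw [TensorialAt.mkHom₂_apply _ _ hY hZ]
    simp [nablaAux, g.symm x (Z x)]

theorem metric_ext (g : Metric E M) {x : M} {a b : TangentSpace 𝓘(ℝ, E) x}
    (h : ∀ w, g.inner x a w = g.inner x b w) : a = b := by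
  by_contra hne
  have h1 := g.pos x (a - b) (sub_ne_zero.2 hne)
  have h2 : g.inner x (a - b) = 0 := by ext w; simp [h]
  rw [h2] at h1
  exact lt_irrefl _ h1

/-- Raising an index of a trilinear form. -/
theorem exists_raise (g : Metric E M) (x : M)
    (F : TangentSpace 𝓘(ℝ, E) x → TangentSpace 𝓘(ℝ, E) x → TangentSpace 𝓘(ℝ, E) x → ℝ)
    (hF : IsTrilinear F) :
    ∃ G : TangentSpace 𝓘(ℝ, E) x →L[ℝ] TangentSpace 𝓘(ℝ, E) x →L[ℝ] TangentSpace 𝓘(ℝ, E) x,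
      ∀ v u w, g.inner x (G v u) w = F v u w := by
  have : FiniteDimensional ℝ (TangentSpace 𝓘(ℝ, E) x) := inferInstanceAs (FiniteDimensional ℝ E)
  have : T2Space (TangentSpace 𝓘(ℝ, E) x) := inferInstanceAs (T2Space E)
  let B : TangentSpace 𝓘(ℝ, E) x →ₗ[ℝ] Module.Dual ℝ (TangentSpace 𝓘(ℝ, E) x) :=
    { toFun := fun v ↦ (g.inner x v : TangentSpace 𝓘(ℝ, E) x →ₗ[ℝ] ℝ)
      map_add' := by intros; ext; simp
      map_smul' := by intros; ext; simp }
  have hinj : Function.Injective B := by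
    rw [← LinearMap.ker_eq_bot, LinearMap.ker_eq_bot']
    intro v hv
    by_contra h
    have := g.pos x v h
    have h' : B v v = 0 := by rw [hv]; rfl
    exact this.ne' h'
  have hsurj : Function.Surjective B :=
    (LinearMap.injective_iff_surjective_of_finrank_eq_finrank
      Subspace.dual_finrank_eq.symm).1 hinj
  have hne : ∀ a b, (∀ w, g.inner x a w = g.inner x b w) → a = b := fun a b h ↦
    hinj (LinearMap.ext h)
  have : ∀ v u, ∃ a, ∀ w, g.inner x a w = F v u w := by
    intro v u
    obtain ⟨a, ha⟩ := hsurj (hF.right v u).mk'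
    exact ⟨a, fun w ↦ congrArg (fun L : Module.Dual ℝ (TangentSpace 𝓘(ℝ, E) x) ↦ L w) ha⟩
  choose G hG using this
  have H : IsBilinearMap ℝ G :=
    { add_left := fun v v' u ↦ hne _ _ fun w ↦ by simp [hG, (hF.left u w).map_add]
      smul_left := fun c v u ↦ hne _ _ fun w ↦ by simp [hG, (hF.left u w).map_smul]
      add_right := fun v u u' ↦ hne _ _ fun w ↦ by simp [hG, (hF.mid v w).map_add]
      smul_right := fun c v u ↦ hne _ _ fun w ↦ by simp [hG, (hF.mid v w).map_smul] }
  exact ⟨H.toLinearMap.toContinuousBilinearMap, hG⟩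

theorem isDiffAt_extend (x : M) (v : TangentSpace 𝓘(ℝ, E) x) :
    IsDiffAt (FiberBundle.extend E v) x :=
  FiberBundle.mdifferentiableAt_extend 𝓘(ℝ, E) E v

theorem exists_leviCivita (g : Metric E M) : ∃ cov : Connection E M, IsLeviCivita g cov := by
  choose N hN hNs hN' using exists_nabla g (chartCov (E := E) (M := M))
  let T := (chartCov (E := E) (M := M)).torsion
  have hT : ∀ x u v, T x u v = - T x v u := fun x u v ↦ CovariantDerivative.torsion_antisymm ..
  have hTg : ∀ x, IsTrilinear fun u v w ↦ g.inner x (T x u v) w := fun x ↦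
    ⟨fun u w ↦ ⟨fun a b ↦ by simp, fun c a ↦ by simp⟩,
     fun u w ↦ ⟨fun a b ↦ by simp, fun c a ↦ by simp⟩,
     fun u w ↦ ⟨fun a b ↦ by simp, fun c a ↦ by simp⟩⟩
  choose t ht using fun x ↦ (⟨_, hTg x, fun _ _ _ ↦ rfl⟩ : ∃ t, IsTrilinear t ∧
    ∀ u v w, g.inner x (T x u v) w = t u v w)
  have hts : ∀ x u v w, t x u v w = - t x v u w := by
    intro x u v w
    rw [← (ht x).2, ← (ht x).2, hT]; simp
  choose G hG using fun x ↦ exists_raise g x (fun v u w ↦ (N x v w u + N x u w v - N x u v w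
    - t x u v w + t x u w v + t x v w u) / 2)
    ⟨fun u w ↦ ⟨fun a b ↦ by
        simp only [(hN x).left _ _ |>.map_add, (hN x).mid _ _ |>.map_add,
          (hN x).right _ _ |>.map_add, (ht x).1.left _ _ |>.map_add, (ht x).1.mid _ _ |>.map_add,
          (ht x).1.right _ _ |>.map_add]
        ring, fun c a ↦ by
        simp only [(hN x).left _ _ |>.map_smul, (hN x).mid _ _ |>.map_smul,
          (hN x).right _ _ |>.map_smul, (ht x).1.left _ _ |>.map_smul,
          (ht x).1.mid _ _ |>.map_smul, (ht x).1.right _ _ |>.map_smul, smul_eq_mul]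
        ring⟩,
     fun u w ↦ ⟨fun a b ↦ by
        simp only [(hN x).left _ _ |>.map_add, (hN x).mid _ _ |>.map_add,
          (hN x).right _ _ |>.map_add, (ht x).1.left _ _ |>.map_add, (ht x).1.mid _ _ |>.map_add,
          (ht x).1.right _ _ |>.map_add]
        ring, fun c a ↦ by
        simp only [(hN x).left _ _ |>.map_smul, (hN x).mid _ _ |>.map_smul,
          (hN x).right _ _ |>.map_smul, (ht x).1.left _ _ |>.map_smul,
          (ht x).1.mid _ _ |>.map_smul, (ht x).1.right _ _ |>.map_smul, smul_eq_mul]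
        ring⟩,
     fun u w ↦ ⟨fun a b ↦ by
        simp only [(hN x).left _ _ |>.map_add, (hN x).mid _ _ |>.map_add,
          (hN x).right _ _ |>.map_add, (ht x).1.left _ _ |>.map_add, (ht x).1.mid _ _ |>.map_add,
          (ht x).1.right _ _ |>.map_add]
        ring, fun c a ↦ by
        simp only [(hN x).left _ _ |>.map_smul, (hN x).mid _ _ |>.map_smul,
          (hN x).right _ _ |>.map_smul, (ht x).1.left _ _ |>.map_smul,
          (ht x).1.mid _ _ |>.map_smul, (ht x).1.right _ _ |>.map_smul, smul_eq_mul]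
        ring⟩⟩
  refine ⟨chartCov.addOneForm G, ?_, ?_⟩
  · intro x Y Z hY hZ u
    rw [hN' x Y Z hY hZ]
    change _ = g.inner x (chartCov Y x u + G x (Y x) u) (Z x) +
      g.inner x (Y x) (chartCov Z x u + G x (Z x) u)
    have e1 : g.inner x (Y x) (G x (Z x) u) = _ := (g.symm _ _ _).trans (hG x (Z x) u (Y x))
    simp only [map_add, add_apply, hG, e1]
    rw [hNs x (Z x) (Y x), hts x (Z x) (Y x)]
    ring
  · refine (CovariantDerivative.torsion_eq_zero_iff _).2 fun {X Y x} hX hY ↦ ?_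
    have e1 := (chartCov (E := E) (M := M)).torsion_apply hX hY
    have e2 : G x (Y x) (X x) - G x (X x) (Y x) = - T x (X x) (Y x) := by
      refine metric_ext g fun w ↦ ?_
      simp only [map_sub, sub_apply, map_neg, neg_apply, hG, (ht x).2]
      rw [hNs x (Y x) (X x), hts x (Y x) (X x)]
      ring
    change (chartCov Y x (X x) + G x (Y x) (X x)) - (chartCov X x (Y x) + G x (X x) (Y x)) = _
    have e3 : T x (X x) (Y x) = _ := e1
    rw [add_sub_add_comm, e2, e3]
    abel

theorem exists_chern (g : Metric E M) (hg : IsHermitian g) :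
    ∃ cov : Connection E M, IsChern g cov := by
  choose N hN hNs hN' using exists_nabla g (chartCov (E := E) (M := M))
  have hJ : ∀ (x : M) (u v : TangentSpace 𝓘(ℝ, E) x),
      g.inner x (J x u) v = - g.inner x u (J x v) := by
    intro x u v
    rw [← hg x u (J x v), J_J]; simp
  have hNJ : ∀ x u v w, N x (J x u) v w = - N x u (J x v) w := by
    intro x u v w
    have hu := isDiffAt_extend x u
    have hv := isDiffAt_extend x v
    have h1 := hN' x _ _ hu.J hv w
    have h2 := hN' x _ _ hu hv.J w
    have h3 : (fun y ↦ g.inner y (J y (FiberBundle.extend E u y)) (FiberBundle.extend E v y)) =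
      - fun y ↦ g.inner y (FiberBundle.extend E u y) (J y (FiberBundle.extend E v y)) := by
      ext y; exact hJ y _ _
    rw [h3, mvfderiv_neg, neg_apply, h2, chartCov_J hu, chartCov_J hv] at h1
    simp only [FiberBundle.extend_apply_self, hJ] at h1
    linarith
  choose A hA using fun x ↦ exists_raise g x (fun v u w ↦ (N x v w u + N x v (J x w) (J x u)) / 2)
    ⟨fun u w ↦ ⟨fun a b ↦ by
        simp only [map_add, (hN x).left _ _ |>.map_add, (hN x).mid _ _ |>.map_add,
          (hN x).right _ _ |>.map_add]
        ring, fun c a ↦ by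
        simp only [map_smul, (hN x).left _ _ |>.map_smul, (hN x).mid _ _ |>.map_smul,
          (hN x).right _ _ |>.map_smul, smul_eq_mul]
        ring⟩,
     fun u w ↦ ⟨fun a b ↦ by
        simp only [map_add, (hN x).left _ _ |>.map_add, (hN x).mid _ _ |>.map_add,
          (hN x).right _ _ |>.map_add]
        ring, fun c a ↦ by
        simp only [map_smul, (hN x).left _ _ |>.map_smul, (hN x).mid _ _ |>.map_smul,
          (hN x).right _ _ |>.map_smul, smul_eq_mul]
        ring⟩,
     fun u w ↦ ⟨fun a b ↦ by
        simp only [map_add, (hN x).left _ _ |>.map_add, (hN x).mid _ _ |>.map_add,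
          (hN x).right _ _ |>.map_add]
        ring, fun c a ↦ by
        simp only [map_smul, (hN x).left _ _ |>.map_smul, (hN x).mid _ _ |>.map_smul,
          (hN x).right _ _ |>.map_smul, smul_eq_mul]
        ring⟩⟩
  have hneg : ∀ x u v w, N x u v (-w) = - N x u v w := fun x u v w ↦ ((hN x).right u v).map_neg w
  have hneg' : ∀ x u v w, N x u (-v) w = - N x u v w := fun x u v w ↦ ((hN x).mid u w).map_neg v
  refine ⟨chartCov.addOneForm A, ?_, ?_, ?_⟩
  · intro x Y Z hY hZ u
    rw [hN' x Y Z hY hZ]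
    change _ = g.inner x (chartCov Y x u + A x (Y x) u) (Z x) +
      g.inner x (Y x) (chartCov Z x u + A x (Z x) u)
    have e1 : g.inner x (Y x) (A x (Z x) u) = _ := (g.symm _ _ _).trans (hA x (Z x) u (Y x))
    simp only [map_add, add_apply, hA, e1]
    rw [hNs x (Z x) (Y x), hNs x (Z x) (J x (Y x)), hNJ]
    ring
  · intro x Z hZ u
    change chartCov (fun y ↦ J y (Z y)) x u + A x (J x (Z x)) u =
      J x (chartCov Z x u + A x (Z x) u)
    rw [chartCov_J hZ, map_add]
    congr 1
    refine metric_ext g fun w ↦ ?_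
    rw [hJ, hA, hA, hNJ, hNJ, J_J, hneg']
    ring
  · intro x Z hZ u
    change chartCov Z x (J x u) + A x (Z x) (J x u) = J x (chartCov Z x u + A x (Z x) u)
    rw [chartCov_holomorphic hZ, map_add]
    congr 1
    refine metric_ext g fun w ↦ ?_
    rw [hJ, hA, hA, J_J, J_J, hneg, hneg']
    ring

/-- The Levi-Civita connection of `g`. (Its defining properties determine `∇ Z` at every point where
the vector field `Z` is differentiable.) -/
noncomputable def leviCivita (g : Metric E M) : Connection E M := (exists_leviCivita g).choose

theorem isLeviCivita_leviCivita (g : Metric E M) : IsLeviCivita g (leviCivita g) :=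
  (exists_leviCivita g).choose_spec

/-- The Chern connection of the Hermitian metric `g`. (Its defining properties determine `∇ Z` at
every point where the vector field `Z` is differentiable.) -/
noncomputable def chern (g : Metric E M) (hg : IsHermitian g) : Connection E M :=
  (exists_chern g hg).choose

theorem isChern_chern (g : Metric E M) (hg : IsHermitian g) : IsChern g (chern g hg) :=
  (exists_chern g hg).choose_spec

/-- The curvature `R(X, Y) Z = ∇_X ∇_Y Z - ∇_Y ∇_X Z - ∇_{[X, Y]} Z` of a connection. -/
noncomputable def curvature (cov : Connection E M) (X Y Z : VField E M) : VField E M := fun x ↦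
  cov (fun y ↦ cov Z y (Y y)) x (X x) - cov (fun y ↦ cov Z y (X y)) x (Y x) -
    cov Z x (VectorField.mlieBracket 𝓘(ℝ, E) X Y x)

/-- The fundamental form `ω(u, v) = g(Ju, v)`. -/
noncomputable def fundamentalForm (g : Metric E M) (x : M) (u v : TangentSpace 𝓘(ℝ, E) x) : ℝ :=
  g.inner x (J x u) v

/-- The exterior derivative of the fundamental form, by the invariant formula
`dω(X, Y, Z) = X ω(Y, Z) + Y ω(Z, X) + Z ω(X, Y) - ω([X, Y], Z) - ω([Y, Z], X) - ω([Z, X], Y)`. -/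
noncomputable def dFundamentalForm (g : Metric E M) (X Y Z : VField E M) (x : M) : ℝ :=
  mvfderiv 𝓘(ℝ, E) (fun y ↦ fundamentalForm g y (Y y) (Z y)) x (X x) +
  mvfderiv 𝓘(ℝ, E) (fun y ↦ fundamentalForm g y (Z y) (X y)) x (Y x) +
  mvfderiv 𝓘(ℝ, E) (fun y ↦ fundamentalForm g y (X y) (Y y)) x (Z x) -
  fundamentalForm g x (VectorField.mlieBracket 𝓘(ℝ, E) X Y x) (Z x) -
  fundamentalForm g x (VectorField.mlieBracket 𝓘(ℝ, E) Y Z x) (X x) -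
  fundamentalForm g x (VectorField.mlieBracket 𝓘(ℝ, E) Z X x) (Y x)

/-- The Hermitian metric `g` is Kähler: its fundamental form is closed. -/
def IsKahler (g : Metric E M) : Prop :=
  ∀ (x : M) (X Y Z : VField E M), IsSmoothAt X x → IsSmoothAt Y x → IsSmoothAt Z x →
    dFundamentalForm g X Y Z x = 0

end Metric

end HermitianGeometry

/-! Let D be the Levi-Civita connection, N the Chern connection and T the torsion of N. Fix x and u
in the tangent space at x, and let X be the field with value u that is constant in the chart at x.
It is holomorphic, JX is again constant in that chart, and [X, JX] = 0. On such fields the Koszul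
formula (`IsLeviCivita.koszul`) and its Chern analogue (`IsChern.inner_cov_constField`) express both
connections through first derivatives of the metric.

Only ⟨R(X, JX)X, JX⟩ at x is needed. Metric compatibility splits it into derivatives of ⟨∇_{JX} X,
JX⟩ and ⟨∇_X X, JX⟩, plus terms quadratic in ∇. Those two functions are the same for D and N near x
(`inner_cov_J_self_J`, `inner_cov_self_self_J`), so the second derivatives of the metric drop out.
At x one has D_u(JX) = J N_u X and D_u X - D_{Ju}(JX) = 2 N_u X. With these, equality of the
quadratic terms reads |D_u X - N_u X|² = 0 (`leviCivita_eq_chern_self`).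

By polarisation this is a statement about torsion: ⟨T(w, u), u⟩ = 0 for all u and w
(`inner_chern_torsion_self`). Since T is complex bilinear, it must vanish
(`IsChern.torsion_eq_zero`). Then N is itself torsion-free and metric, so it agrees with D, and dω =
0 follows from N g = 0 and N J = 0. -/

namespace HermitianGeometry

/-! ### Fields constant in a chart: J-equivariance, holomorphy, vanishing brackets. -/

section ConstantFields

variable {E : Type*} [NormedAddCommGroup E] [NormedSpace ℂ E]
  {M : Type*} [TopologicalSpace M] [ChartedSpace E M] [IsManifold 𝓘(ℂ, E) ω M]

/-- The vector field with value `v` at `x` and constant in the preferred chart at `x`. -/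
noncomputable abbrev constField {x : M} (v : TangentSpace 𝓘(ℝ, E) x) : VField E M :=
  FiberBundle.extend E v

theorem constField_self {x : M} (v : TangentSpace 𝓘(ℝ, E) x) : constField v x = v :=
  FiberBundle.extend_apply_self (F := E) v

theorem constField_eq_symm {x : M} (v : TangentSpace 𝓘(ℝ, E) x) (y : M) :
    constField v y = (trivializationAt E (TangentSpace 𝓘(ℝ, E)) x).symm y (show E from v) := by
  have := rep_self (constField v) x
  rw [rep, constField_self] at this
  rw [constField, FiberBundle.extend, this]

theorem rep_constField {x y : M} (hy : y ∈ (chartAt E x).source) (v : TangentSpace 𝓘(ℝ, E) x) :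
    rep (constField v) x y = v := by
  rw [rep, constField_eq_symm]
  exact congrArg Prod.snd ((trivializationAt E (TangentSpace 𝓘(ℝ, E)) x).apply_mk_symm hy _)

theorem eq_of_trivialization_eq {x y : M} (hy : y ∈ (chartAt E x).source)
    {v w : TangentSpace 𝓘(ℝ, E) y}
    (h : (trivializationAt E (TangentSpace 𝓘(ℝ, E)) x (⟨y, v⟩ : TangentBundle 𝓘(ℝ, E) M)).2 =
      (trivializationAt E (TangentSpace 𝓘(ℝ, E)) x (⟨y, w⟩ : TangentBundle 𝓘(ℝ, E) M)).2) :
    v = w := by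
  have hv := (trivializationAt E (TangentSpace 𝓘(ℝ, E)) x).symm_apply_apply_mk hy v
  have hw := (trivializationAt E (TangentSpace 𝓘(ℝ, E)) x).symm_apply_apply_mk hy w
  rw [← hv, ← hw, h]

/-- Transition maps are holomorphic, so J is multiplication by i in the chart at x over its whole
domain, not only at x. -/
theorem J_constField {x y : M} (hy : y ∈ (chartAt E x).source) (v : TangentSpace 𝓘(ℝ, E) x) :
    J y (constField v y) = constField (J x v) y := by
  refine eq_of_trivialization_eq hy ?_
  have h1 := rep_constField hy v
  have h2 := rep_constField hy (J x v)
  rw [rep] at h1 h2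
  rw [trivialization_J hy, h1, h2]
  rfl

theorem isSmoothAt_constField {x y : M} (hy : y ∈ (chartAt E x).source)
    (v : TangentSpace 𝓘(ℝ, E) x) : IsSmoothAt (constField v) y := by
  refine ((trivializationAt E (TangentSpace 𝓘(ℝ, E)) x).contMDiffAt_section_iff
    (show y ∈ _ from hy)).2 ?_
  refine (contMDiffAt_const (c := (show E from v))).congr_of_eventuallyEq ?_
  filter_upwards [(chartAt E x).open_source.mem_nhds hy] with z hz
  exact rep_constField hz v

theorem IsSmoothAt.isDiffAt {Z : VField E M} {x : M} (hZ : IsSmoothAt Z x) : IsDiffAt Z x :=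
  ContMDiffAt.mdifferentiableAt hZ (by simp)

theorem isHolomorphicAt_constField {x y : M} (hy : y ∈ (chartAt E x).source)
    (v : TangentSpace 𝓘(ℝ, E) x) : IsHolomorphicAt (constField v) y := by
  filter_upwards [(chartAt E x).open_source.mem_nhds hy] with z hz
  refine ((trivializationAt E (TangentSpace 𝓘(ℂ, E)) x).mdifferentiableAt_section_iff
    𝓘(ℂ, E) (E := TangentSpace 𝓘(ℂ, E)) (constField v) (show z ∈ _ from hz)).2 ?_
  refine (mdifferentiableAt_const (c := (show E from v))).congr_of_eventuallyEq ?_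
  filter_upwards [(chartAt E x).open_source.mem_nhds hz] with t ht
  exact (trivialization_real_complex ht (constField v t)).symm.trans (rep_constField ht v)

theorem mfderiv_extChartAt_constField {x y : M} (hy : y ∈ (chartAt E x).source)
    (v : TangentSpace 𝓘(ℝ, E) x) :
    mfderiv 𝓘(ℝ, E) 𝓘(ℝ, E) (extChartAt 𝓘(ℝ, E) x) y (constField v y) = v := by
  rw [← TangentBundle.continuousLinearMapAt_trivializationAt hy]
  refine Eq.trans ?_ (rep_constField hy v)
  exact (trivializationAt E (TangentSpace 𝓘(ℝ, E)) x).continuousLinearMapAt_apply_of_mem ℝ hy _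

/-- Reduces brackets of these fields to brackets of constant fields on E, since the bracket commutes
with pullback by the chart. The field `V` is pinned down by `hV`, which keeps it typed as a section
of the tangent bundle of E. -/
theorem constField_eventuallyEq_mpullback {x y : M} (hy : y ∈ (chartAt E x).source)
    (v : TangentSpace 𝓘(ℝ, E) x) (V : Π z : E, TangentSpace 𝓘(ℝ, E) z) (hV : ∀ z, V z = v) :
    constField v =ᶠ[𝓝 y]
      VectorField.mpullback 𝓘(ℝ, E) 𝓘(ℝ, E) (extChartAt 𝓘(ℝ, E) x) V := by
  filter_upwards [(chartAt E x).open_source.mem_nhds hy] with z hz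
  rw [VectorField.mpullback_apply, hV]
  exact ((isInvertible_mfderiv_extChartAt (by simpa using hz)).inverse_apply_eq.2
    (mfderiv_extChartAt_constField hz v).symm).symm

theorem lieBracket_eq_zero_of_const {V W : E → E} {v w : E} (hV : ∀ z, V z = v)
    (hW : ∀ z, W z = w) : VectorField.lieBracketWithin ℝ V W Set.univ = 0 := by
  obtain rfl : V = fun _ ↦ v := funext hV
  obtain rfl : W = fun _ ↦ w := funext hW
  ext z
  simp [VectorField.lieBracketWithin]

theorem mdifferentiableAt_of_const {V : Π z : E, TangentSpace 𝓘(ℝ, E) z} {v : E}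
    (hV : ∀ z, V z = v) (z : E) :
    MDifferentiableAt 𝓘(ℝ, E) (𝓘(ℝ, E).prod 𝓘(ℝ, E)) (fun y ↦ TotalSpace.mk' E y (V y)) z := by
  rw [mdifferentiableAt_section]
  refine (mdifferentiableAt_const (c := v)).congr_of_eventuallyEq (Filter.Eventually.of_forall ?_)
  intro y
  have h := hV y
  simp only [trivializationAt_model_space_apply]
  exact h

theorem mlieBracket_constField [CompleteSpace E] {x y : M} (hy : y ∈ (chartAt E x).source)
    (u v : TangentSpace 𝓘(ℝ, E) x) :
    VectorField.mlieBracket 𝓘(ℝ, E) (constField u) (constField v) y = 0 := by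
  obtain ⟨U, hU⟩ : ∃ U : Π z : E, TangentSpace 𝓘(ℝ, E) z, ∀ z, U z = u :=
    ⟨fun _ ↦ (u : E), fun _ ↦ rfl⟩
  obtain ⟨V, hV⟩ : ∃ V : Π z : E, TangentSpace 𝓘(ℝ, E) z, ∀ z, V z = v :=
    ⟨fun _ ↦ (v : E), fun _ ↦ rfl⟩
  rw [(constField_eventuallyEq_mpullback hy u U hU).mlieBracket_vectorField_eq
      (constField_eventuallyEq_mpullback hy v V hV),
    ← VectorField.mpullback_mlieBracket (n := ω) (mdifferentiableAt_of_const hU _)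
      (mdifferentiableAt_of_const hV _) (contMDiffAt_extChartAt' hy) (by simp [minSmoothness]),
    VectorField.mpullback_apply, ← VectorField.mlieBracketWithin_univ,
    VectorField.mlieBracketWithin_eq_lieBracketWithin]
  exact (congrArg _ (congrFun (lieBracket_eq_zero_of_const hU hV) _)).trans (map_zero _)

end ConstantFields

/-! ### Differentiability of metric coefficients, and of fields tested against the metric. -/

section Regularity

variable {E : Type*} [NormedAddCommGroup E] [NormedSpace ℂ E] [FiniteDimensional ℂ E]
  {M : Type*} [TopologicalSpace M] [ChartedSpace E M] [IsManifold 𝓘(ℂ, E) ω M]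

theorem mvfderiv_real_congr {f f' : M → ℝ} {x : M} (h : f =ᶠ[𝓝 x] f') :
    mvfderiv 𝓘(ℝ, E) f x = mvfderiv 𝓘(ℝ, E) f' x := by
  ext v
  have := h.mfderiv_eq (I := 𝓘(ℝ, E)) (I' := 𝓘(ℝ, ℝ))
  exact congrArg (fun L : E →L[ℝ] ℝ ↦ L v) this

theorem contMDiffAt_inner (g : Metric E M) {Y Z : VField E M} {x : M} (hY : IsSmoothAt Y x)
    (hZ : IsSmoothAt Z x) :
    ContMDiffAt 𝓘(ℝ, E) 𝓘(ℝ, ℝ) ∞ (fun y ↦ g.inner y (Y y) (Z y)) x := by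
  have : ContMDiffAt 𝓘(ℝ, E) (𝓘(ℝ, E).prod 𝓘(ℝ)) ∞
      (fun m ↦ TotalSpace.mk' ℝ (E := Bundle.Trivial M ℝ) m (g.inner m (Y m) (Z m))) x := by
    apply ContMDiffAt.clm_bundle_apply₂ (F₁ := E) (F₂ := E)
    · exact g.contMDiff.contMDiffAt
    · exact hY
    · exact hZ
  simp only [contMDiffAt_totalSpace] at this
  exact this.2

/-- The derivative of a smooth function along a constant field is differentiable. -/
theorem mdifferentiableAt_mvfderiv_constField {f : M → ℝ} {x : M}
    (hf : ContMDiffAt 𝓘(ℝ, E) 𝓘(ℝ, ℝ) ∞ f x) (v : TangentSpace 𝓘(ℝ, E) x) :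
    MDifferentiableAt 𝓘(ℝ, E) 𝓘(ℝ, ℝ)
      (fun y ↦ mvfderiv 𝓘(ℝ, E) f y (constField v y)) x := by
  let F : E → ℝ := f ∘ (extChartAt 𝓘(ℝ, E) x).symm
  have hF : ContDiffAt ℝ ∞ F (extChartAt 𝓘(ℝ, E) x x) := by
    have := (contMDiffAt_iff.1 hf).2
    simpa [contDiffWithinAt_univ, F, chartAt_self_eq, Function.comp_def] using this
  -- In the chart the constant field is the fixed vector `v`, so the function in question is `fderiv
  -- ℝ F · v` composed with the chart.
  have h1 : DifferentiableAt ℝ (fun z ↦ fderiv ℝ F z (show E from v)) (extChartAt 𝓘(ℝ, E) x x) :=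
    ((hF.fderiv_right (m := 1) (by norm_cast)).differentiableAt one_ne_zero).clm_apply
      (differentiableAt_const _)
  refine (h1.comp_mdifferentiableAt (mdifferentiableAt_extChartAt
    (mem_chart_source E x))).congr_of_eventuallyEq ?_
  have h2 : ∀ᶠ y in 𝓝 x, DifferentiableAt ℝ F (extChartAt 𝓘(ℝ, E) x y) := by
    have := (hF.of_le (m := 1) (by norm_cast)).eventually (by simp)
    filter_upwards [(continuousAt_extChartAt (I := 𝓘(ℝ, E)) x).eventually this] with y hy
    exact hy.differentiableAt one_ne_zero
  filter_upwards [h2, source_mem (E := E) x] with y hy hys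
  have h3 : f =ᶠ[𝓝 y] F ∘ extChartAt 𝓘(ℝ, E) x := by
    filter_upwards [(chartAt E x).open_source.mem_nhds hys] with z hz
    simp only [F, Function.comp_apply]
    rw [(extChartAt 𝓘(ℝ, E) x).left_inv (by simpa using hz)]
  rw [mvfderiv_real_congr h3]
  have h4 := (hy.hasFDerivAt.hasMFDerivAt.comp y
    (mdifferentiableAt_extChartAt (I := 𝓘(ℝ, E)) hys).hasMFDerivAt).mfderiv
  have h5 := mfderiv_extChartAt_constField hys v
  change mfderiv 𝓘(ℝ, E) 𝓘(ℝ, ℝ) (F ∘ extChartAt 𝓘(ℝ, E) x) y (constField v y) =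
    fderiv ℝ F (extChartAt 𝓘(ℝ, E) x y) v
  rw [h4]
  exact congrArg (fderiv ℝ F (extChartAt 𝓘(ℝ, E) x y)) h5

theorem sum_smul_constField {ι : Type*} [Fintype ι] (b : Module.Basis ι ℝ E) {x y : M}
    (hy : y ∈ (chartAt E x).source) (v : TangentSpace 𝓘(ℝ, E) x) :
    ∑ i, b.repr v i • constField (x := x) (b i) y = constField v y := by
  have h : ∀ w : TangentSpace 𝓘(ℝ, E) x, constField w y =
      (trivializationAt E (TangentSpace 𝓘(ℝ, E)) x).symmL ℝ y w := by
    intro w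
    exact (constField_eq_symm w y).trans
      ((trivializationAt E (TangentSpace 𝓘(ℝ, E)) x).symmL_apply hy _).symm
  rw [h v]
  conv_rhs => rw [← b.sum_repr v, map_sum]
  refine Finset.sum_congr rfl fun i _ ↦ ?_
  rw [map_smul]
  congr 1
  exact h _

theorem constField_rep (W : VField E M) {x y : M} (hy : y ∈ (chartAt E x).source) :
    constField (x := x) (rep (E := E) W x y) y = W y :=
  eq_of_trivialization_eq hy (rep_constField hy (rep (E := E) W x y))

/-- A continuous linear map depending differentiably on the point and invertible at `x` reflects
differentiability at `x`. -/
theorem mdifferentiableAt_of_clm_apply {F G : Type*} [NormedAddCommGroup F] [NormedSpace ℝ F]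
    [CompleteSpace F] [NormedAddCommGroup G] [NormedSpace ℝ G] {Φ : M → F →L[ℝ] G} {r : M → F}
    {x : M} (hΦ : MDifferentiableAt 𝓘(ℝ, E) 𝓘(ℝ, F →L[ℝ] G) Φ x)
    (e : F ≃L[ℝ] G) (he : Φ x = e)
    (hr : MDifferentiableAt 𝓘(ℝ, E) 𝓘(ℝ, G) (fun y ↦ Φ y (r y)) x) :
    MDifferentiableAt 𝓘(ℝ, E) 𝓘(ℝ, F) r x := by
  -- Invertibility is an open condition and inversion is differentiable, so near x one recovers r as
  -- Φ⁻¹(Φ r).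
  have h1 : DifferentiableAt ℝ ContinuousLinearMap.inverse (Φ x) := by
    rw [he]
    exact (contDiffAt_map_inverse (n := 1) e).differentiableAt one_ne_zero
  refine ((h1.comp_mdifferentiableAt hΦ).clm_apply hr).congr_of_eventuallyEq ?_
  have h2 : Set.range ((↑) : (F ≃L[ℝ] G) → F →L[ℝ] G) ∈ 𝓝 (Φ x) := by
    rw [he]
    exact ContinuousLinearEquiv.nhds e
  filter_upwards [hΦ.continuousAt.eventually h2] with y hy
  obtain ⟨e', he'⟩ := hy
  simp [← he']

/-- A vector field is differentiable as soon as its inner products with the constant fields are. -/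
theorem isDiffAt_of_inner (g : Metric E M) {W : VField E M} {x : M}
    (h : ∀ w : TangentSpace 𝓘(ℝ, E) x, MDifferentiableAt 𝓘(ℝ, E) 𝓘(ℝ, ℝ)
      (fun y ↦ g.inner y (W y) (constField w y)) x) : IsDiffAt W x := by
  rw [isDiffAt_iff]
  have : FiniteDimensional ℝ E := FiniteDimensional.complexToReal E
  have : CompleteSpace E := FiniteDimensional.complete ℝ E
  let b := Module.finBasis ℝ E
  let X : Fin (Module.finrank ℝ E) → VField E M := fun i ↦ constField (x := x) (b i)
  let ε : Fin (Module.finrank ℝ E) → E →L[ℝ] ℝ := fun i ↦ (b.coord i).toContinuousLinearMap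
  -- This is the metric at y read in the chart as a map from E to its dual. Written with its Gram
  -- matrix, its dependence on y is visibly differentiable.
  let Φ : M → E →L[ℝ] E →L[ℝ] ℝ := fun y ↦
    ∑ i, ∑ j, g.inner y (X i y) (X j y) • (ε i).smulRight (ε j)
  have hsum : ∀ y ∈ (chartAt E x).source, ∀ a : E, ∑ i, ε i a • X i y = constField (x := x) a y :=
    fun y hy a ↦ sum_smul_constField b hy a
  have hΦ : ∀ y ∈ (chartAt E x).source, ∀ a : E,
      Φ y a = ∑ j, g.inner y (constField (x := x) a y) (X j y) • ε j := by
    intro y hy a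
    ext c
    simp only [Φ, ← hsum y hy, map_sum, map_smul, sum_apply, smul_apply, smul_eq_mul,
      ContinuousLinearMap.smulRight_apply, Finset.sum_mul]
    rw [Finset.sum_comm]
    refine Finset.sum_congr rfl fun i _ ↦ Finset.sum_congr rfl fun j _ ↦ ?_
    ring
  have hΦ' : ∀ y ∈ (chartAt E x).source, ∀ a c : E,
      Φ y a c = g.inner y (constField (x := x) a y) (constField (x := x) c y) := by
    intro y hy a c
    rw [hΦ y hy, ← hsum y hy c]
    simp [mul_comm]
  have hsmooth : ∀ i, IsSmoothAt (X i) x := fun i ↦ isSmoothAt_constField (mem_chart_source E x) _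
  have hΦd : MDifferentiableAt 𝓘(ℝ, E) 𝓘(ℝ, E →L[ℝ] E →L[ℝ] ℝ) Φ x := by
    have h1 : ∀ i j, MDifferentiableAt 𝓘(ℝ, E) 𝓘(ℝ, E →L[ℝ] E →L[ℝ] ℝ)
        (fun y ↦ g.inner y (X i y) (X j y) • (ε i).smulRight (ε j)) x := fun i j ↦
      (inner_diff g (hsmooth i).isDiffAt (hsmooth j).isDiffAt).smul mdifferentiableAt_const
    have h2 : ∀ i, MDifferentiableAt 𝓘(ℝ, E) 𝓘(ℝ, E →L[ℝ] E →L[ℝ] ℝ)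
        (fun y ↦ ∑ j, g.inner y (X i y) (X j y) • (ε i).smulRight (ε j)) x := fun i ↦ by
      simpa only [Finset.sum_fn] using MDifferentiableAt.sum (t := Finset.univ) fun j _ ↦ h1 i j
    simpa only [Finset.sum_fn] using MDifferentiableAt.sum (t := Finset.univ) fun i _ ↦ h2 i
  have hinj : Function.Injective (Φ x) := by
    rw [injective_iff_map_eq_zero]
    intro a ha
    by_contra hne
    have h1 := hΦ' x (mem_chart_source E x) a a
    rw [ha] at h1
    have h2 := g.pos x (constField (x := x) a x)
      (by rw [constField_self (E := E) (x := x) a]; exact hne)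
    exact h2.ne h1
  let e : E ≃ₗ[ℝ] (E →L[ℝ] ℝ) := LinearEquiv.ofInjectiveOfFinrankEq (Φ x : E →ₗ[ℝ] E →L[ℝ] ℝ)
    hinj (by
      rw [← Subspace.dual_finrank_eq]
      exact (LinearMap.toContinuousLinearMap (𝕜 := ℝ) (E := E) (F' := ℝ)).finrank_eq)
  -- Applied to the chart expression of W, Φ gives the functional with coefficients ⟨W, X_j⟩, which
  -- are differentiable by hypothesis.
  refine mdifferentiableAt_of_clm_apply hΦd e.toContinuousLinearEquiv (by ext; rfl) ?_
  have h2 : MDifferentiableAt 𝓘(ℝ, E) 𝓘(ℝ, E →L[ℝ] ℝ)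
      (fun y ↦ ∑ j, g.inner y (W y) (X j y) • ε j) x := by
    have h1 : ∀ j, MDifferentiableAt 𝓘(ℝ, E) 𝓘(ℝ, E →L[ℝ] ℝ)
        (fun y ↦ g.inner y (W y) (X j y) • ε j) x := fun j ↦
      (h _).smul mdifferentiableAt_const
    simpa only [Finset.sum_fn] using MDifferentiableAt.sum (t := Finset.univ) fun j _ ↦ h1 j
  refine h2.congr_of_eventuallyEq ?_
  filter_upwards [source_mem (E := E) x] with y hy
  have := hΦ y hy (rep (E := E) W x y)
  rwa [constField_rep W hy] at this

end Regularity

/-! ### Koszul-type formulas for both connections, and their curvature on constant fields. -/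

section Connections

variable {E : Type*} [NormedAddCommGroup E] [NormedSpace ℂ E] [FiniteDimensional ℂ E]
  {M : Type*} [TopologicalSpace M] [ChartedSpace E M] [IsManifold 𝓘(ℂ, E) ω M]

theorem cov_congr (cov : Connection E M) {Z W : VField E M} {x : M} (hZ : IsDiffAt Z x)
    (hW : IsDiffAt W x) (h : Z =ᶠ[𝓝 x] W) : cov Z x = cov W x :=
  cov.isCovariantDerivativeOn.congr_of_eventuallyEq hZ hW Filter.univ_mem h

theorem IsHermitian.inner_J_left {g : Metric E M} (hg : IsHermitian g) {x : M}
    (u v : TangentSpace 𝓘(ℝ, E) x) : g.inner x (J x u) v = -g.inner x u (J x v) := by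
  rw [← hg x u (J x v), J_J]; simp

theorem IsHermitian.inner_J_self {g : Metric E M} (hg : IsHermitian g) {x : M}
    (u : TangentSpace 𝓘(ℝ, E) x) : g.inner x u (J x u) = 0 := by
  have := hg.inner_J_left u u
  rw [g.symm] at this
  linarith

/-- The component of the metric on two constant fields. -/
noncomputable def metricCoeff (g : Metric E M) {x : M} (v w : TangentSpace 𝓘(ℝ, E) x) (y : M) : ℝ :=
  g.inner y (constField v y) (constField w y)

theorem metricCoeff_symm (g : Metric E M) {x : M} (v w : TangentSpace 𝓘(ℝ, E) x) :
    metricCoeff g v w = metricCoeff g w v :=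
  funext fun _ ↦ g.symm _ _ _

theorem contMDiffAt_metricCoeff (g : Metric E M) {x : M} (v w : TangentSpace 𝓘(ℝ, E) x) :
    ContMDiffAt 𝓘(ℝ, E) 𝓘(ℝ, ℝ) ∞ (metricCoeff g v w) x :=
  contMDiffAt_inner g (isSmoothAt_constField (mem_chart_source E x) v)
    (isSmoothAt_constField (mem_chart_source E x) w)

theorem isDiffAt_constField {x y : M} (hy : y ∈ (chartAt E x).source)
    (v : TangentSpace 𝓘(ℝ, E) x) : IsDiffAt (constField v) y :=
  (isSmoothAt_constField hy v).isDiffAt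

theorem mvfderiv_metricCoeff_J_J {g : Metric E M} (hg : IsHermitian g) {x y : M}
    (hy : y ∈ (chartAt E x).source) (v w : TangentSpace 𝓘(ℝ, E) x) :
    mvfderiv 𝓘(ℝ, E) (metricCoeff g (J x v) (J x w)) y =
      mvfderiv 𝓘(ℝ, E) (metricCoeff g v w) y := by
  refine mvfderiv_real_congr ?_
  filter_upwards [(chartAt E x).open_source.mem_nhds hy] with z hz
  simp only [metricCoeff, ← J_constField hz, hg z]

theorem mvfderiv_metricCoeff_J_right {g : Metric E M} (hg : IsHermitian g) {x y : M}
    (hy : y ∈ (chartAt E x).source) (v w : TangentSpace 𝓘(ℝ, E) x) (a : TangentSpace 𝓘(ℝ, E) y) :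
    mvfderiv 𝓘(ℝ, E) (metricCoeff g v (J x w)) y a =
      -mvfderiv 𝓘(ℝ, E) (metricCoeff g (J x v) w) y a := by
  rw [← neg_apply, ← mvfderiv_neg]
  refine congrArg (fun L ↦ L a) (mvfderiv_real_congr ?_)
  filter_upwards [(chartAt E x).open_source.mem_nhds hy] with z hz
  simp only [metricCoeff, ← J_constField hz, Pi.neg_apply, hg.inner_J_left, neg_neg]

theorem mvfderiv_metricCoeff_self_J {g : Metric E M} (hg : IsHermitian g) {x y : M}
    (hy : y ∈ (chartAt E x).source) (v : TangentSpace 𝓘(ℝ, E) x) (a : TangentSpace 𝓘(ℝ, E) y) :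
    mvfderiv 𝓘(ℝ, E) (metricCoeff g v (J x v)) y a = 0 := by
  have h : metricCoeff g v (J x v) =ᶠ[𝓝 y] fun _ ↦ (0 : ℝ) := by
    filter_upwards [(chartAt E x).open_source.mem_nhds hy] with z hz
    simp only [metricCoeff, ← J_constField hz, hg.inner_J_self]
  rw [mvfderiv_real_congr h, mvfderiv_const, zero_apply]

theorem IsMetricCompatible.mvfderiv_metricCoeff {g : Metric E M} {cov : Connection E M}
    (h : IsMetricCompatible g cov) {x y : M} (hy : y ∈ (chartAt E x).source)
    (v w : TangentSpace 𝓘(ℝ, E) x) (a : TangentSpace 𝓘(ℝ, E) y) :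
    mvfderiv 𝓘(ℝ, E) (metricCoeff g v w) y a =
      g.inner y (cov (constField v) y a) (constField w y) +
        g.inner y (constField v y) (cov (constField w) y a) :=
  h y _ _ (isDiffAt_constField hy v) (isDiffAt_constField hy w) a

theorem IsLeviCivita.cov_constField_comm {g : Metric E M} {cov : Connection E M}
    (h : IsLeviCivita g cov) {x y : M} (hy : y ∈ (chartAt E x).source)
    (u v : TangentSpace 𝓘(ℝ, E) x) :
    cov (constField v) y (constField u y) = cov (constField u) y (constField v y) := by
  have : CompleteSpace E := FiniteDimensional.complete ℂ E
  have h1 := (CovariantDerivative.torsion_eq_zero_iff _).1 h.torsion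
    (isDiffAt_constField hy u) (isDiffAt_constField hy v)
  rwa [mlieBracket_constField hy, sub_eq_zero] at h1

/-- The Koszul formula on constant fields. -/
theorem IsLeviCivita.koszul {g : Metric E M} {cov : Connection E M}
    (h : IsLeviCivita g cov) {x y : M} (hy : y ∈ (chartAt E x).source)
    (u v w : TangentSpace 𝓘(ℝ, E) x) :
    2 * g.inner y (cov (constField v) y (constField u y)) (constField w y) =
      mvfderiv 𝓘(ℝ, E) (metricCoeff g v w) y (constField u y) +
      mvfderiv 𝓘(ℝ, E) (metricCoeff g u w) y (constField v y) -
      mvfderiv 𝓘(ℝ, E) (metricCoeff g u v) y (constField w y) := by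
  rw [h.metric.mvfderiv_metricCoeff hy, h.metric.mvfderiv_metricCoeff hy,
    h.metric.mvfderiv_metricCoeff hy, h.cov_constField_comm hy w u, h.cov_constField_comm hy w v,
    h.cov_constField_comm hy v u, g.symm y (constField v y),
    g.symm y (constField u y) (cov (constField w) y (constField v y))]
  ring

theorem IsChern.cov_constField_J {g : Metric E M} {cov : Connection E M} (h : IsChern g cov)
    {x y : M} (hy : y ∈ (chartAt E x).source) (v : TangentSpace 𝓘(ℝ, E) x)
    (a : TangentSpace 𝓘(ℝ, E) y) :
    cov (constField (J x v)) y a = J y (cov (constField v) y a) := by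
  rw [← h.map_J y _ (isDiffAt_constField hy v)]
  rw [cov_congr cov (isDiffAt_constField hy _) (isDiffAt_constField hy v).J]
  filter_upwards [(chartAt E x).open_source.mem_nhds hy] with z hz
  exact (J_constField hz v).symm

theorem IsChern.cov_constField_apply_J {g : Metric E M} {cov : Connection E M} (h : IsChern g cov)
    {x y : M} (hy : y ∈ (chartAt E x).source) (v : TangentSpace 𝓘(ℝ, E) x)
    (a : TangentSpace 𝓘(ℝ, E) y) :
    cov (constField v) y (J y a) = J y (cov (constField v) y a) :=
  h.holomorphic y _ (isHolomorphicAt_constField hy v) a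

/-- The Chern connection on constant fields, in terms of the metric. -/
theorem IsChern.inner_cov_constField {g : Metric E M} {cov : Connection E M} (h : IsChern g cov)
    (hg : IsHermitian g) {x y : M} (hy : y ∈ (chartAt E x).source)
    (u v w : TangentSpace 𝓘(ℝ, E) x) :
    2 * g.inner y (cov (constField v) y (constField u y)) (constField w y) =
      mvfderiv 𝓘(ℝ, E) (metricCoeff g v w) y (constField u y) +
      mvfderiv 𝓘(ℝ, E) (metricCoeff g v (J x w)) y (constField (J x u) y) := by
  -- Complex linearity turns the second derivative into ⟨J N_u V, JW⟩ + ⟨V, J J N_u W⟩ = ⟨N_u V, W⟩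
  -- - ⟨V, N_u W⟩. Adding the first derivative doubles one term and cancels the other.
  rw [h.metric.mvfderiv_metricCoeff hy, h.metric.mvfderiv_metricCoeff hy,
    h.cov_constField_J hy, ← J_constField hy u, h.cov_constField_apply_J hy,
    h.cov_constField_apply_J hy, ← J_constField hy w, hg y, J_J, map_neg]
  ring

/-- The derivative of a constant field along a constant field is differentiable as soon as its
inner products with the constant fields are given by a differentiable expression. -/
theorem isDiffAt_cov_constField_of_eventually (g : Metric E M) (cov : Connection E M) {x : M}
    (u v : TangentSpace 𝓘(ℝ, E) x)
    (h : ∀ w : TangentSpace 𝓘(ℝ, E) x, ∃ f : M → ℝ, MDifferentiableAt 𝓘(ℝ, E) 𝓘(ℝ, ℝ) f x ∧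
      ∀ y ∈ (chartAt E x).source,
        2 * g.inner y (cov (constField v) y (constField u y)) (constField w y) = f y) :
    IsDiffAt (fun y ↦ cov (constField v) y (constField u y)) x := by
  refine isDiffAt_of_inner g fun w ↦ ?_
  obtain ⟨f, hf, hfe⟩ := h w
  have h1 : MDifferentiableAt 𝓘(ℝ, E) 𝓘(ℝ, ℝ) (fun y ↦ (2⁻¹ : ℝ) • f y) x :=
    hf.const_smul (2⁻¹ : ℝ)
  refine h1.congr_of_eventuallyEq ?_
  filter_upwards [source_mem (E := E) x] with y hy
  rw [← hfe y hy, smul_eq_mul, inv_mul_cancel_left₀ two_ne_zero]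

/-- The axioms of the connection contain no regularity. The Koszul formula supplies what is needed
to apply metric compatibility to ∇_U V itself. -/
theorem IsLeviCivita.isDiffAt_cov_constField {g : Metric E M} {cov : Connection E M}
    (h : IsLeviCivita g cov) {x : M} (u v : TangentSpace 𝓘(ℝ, E) x) :
    IsDiffAt (fun y ↦ cov (constField v) y (constField u y)) x :=
  isDiffAt_cov_constField_of_eventually g cov u v fun w ↦
    ⟨_, ((mdifferentiableAt_mvfderiv_constField (contMDiffAt_metricCoeff g v w) u).add
      (mdifferentiableAt_mvfderiv_constField (contMDiffAt_metricCoeff g u w) v)).sub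
      (mdifferentiableAt_mvfderiv_constField (contMDiffAt_metricCoeff g u v) w),
      fun _ hy ↦ h.koszul hy u v w⟩

theorem IsChern.isDiffAt_cov_constField {g : Metric E M} {cov : Connection E M}
    (h : IsChern g cov) (hg : IsHermitian g) {x : M} (u v : TangentSpace 𝓘(ℝ, E) x) :
    IsDiffAt (fun y ↦ cov (constField v) y (constField u y)) x :=
  isDiffAt_cov_constField_of_eventually g cov u v fun w ↦
    ⟨_, (mdifferentiableAt_mvfderiv_constField (contMDiffAt_metricCoeff g v w) u).add
      (mdifferentiableAt_mvfderiv_constField (contMDiffAt_metricCoeff g v (J x w)) (J x u)),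
      fun _ hy ↦ h.inner_cov_constField hg hy u v w⟩

/-- The bracket term vanishes, and metric compatibility moves the outer derivative off ∇Z, leaving
derivatives of scalar functions and products of first derivatives. -/
theorem IsMetricCompatible.inner_curvature {g : Metric E M} {cov : Connection E M}
    (h : IsMetricCompatible g cov) {x : M}
    (hd : ∀ u v : TangentSpace 𝓘(ℝ, E) x,
      IsDiffAt (fun y ↦ cov (constField v) y (constField u y)) x)
    (u v z w : TangentSpace 𝓘(ℝ, E) x) :
    g.inner x (curvature cov (constField u) (constField v) (constField z) x) w =
      mvfderiv 𝓘(ℝ, E)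
        (fun y ↦ g.inner y (cov (constField z) y (constField v y)) (constField w y)) x u -
      mvfderiv 𝓘(ℝ, E)
        (fun y ↦ g.inner y (cov (constField z) y (constField u y)) (constField w y)) x v -
      g.inner x (cov (constField z) x v) (cov (constField w) x u) +
      g.inner x (cov (constField z) x u) (cov (constField w) x v) := by
  have : CompleteSpace E := FiniteDimensional.complete ℂ E
  have hw := isDiffAt_constField (mem_chart_source E x) w
  rw [h x _ _ (hd v z) hw, h x _ _ (hd u z) hw, curvature,
    mlieBracket_constField (mem_chart_source E x)]
  simp only [constField_self, map_zero, sub_zero, map_sub, sub_apply]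
  ring

/-- Levi-Civita connections agree. -/
theorem IsLeviCivita.unique {g : Metric E M} {cov cov' : Connection E M}
    (h : IsLeviCivita g cov) (h' : IsLeviCivita g cov') {x : M} {Z : VField E M}
    (hZ : IsDiffAt Z x) : cov Z x = cov' Z x := by
  have : FiniteDimensional ℝ E := FiniteDimensional.complexToReal E
  have hx := mem_chart_source E x
  have key : cov (constField (Z x)) x = cov' (constField (Z x)) x := by
    ext u
    refine metric_ext g fun w ↦ ?_
    have h1 := h.koszul hx u (Z x) w
    have h2 := h'.koszul hx u (Z x) w
    simp only [constField_self] at h1 h2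
    linarith
  -- The difference of two connections is tensorial, so agreement on the constant field with value
  -- `Z x` suffices.
  have h1 := cov.isCovariantDerivativeOnUniv.difference_apply cov'.isCovariantDerivativeOnUniv
    (x := x) (hσ := hZ)
  have h2 := cov.isCovariantDerivativeOnUniv.difference_apply cov'.isCovariantDerivativeOnUniv
    (x := x) (hσ := isDiffAt_constField hx (Z x))
  rw [constField_self, h1, key, sub_self, sub_eq_zero] at h2
  exact h2

end Connections

/-! ### Comparing the two connections: from curvature to torsion to the Kähler condition. -/

section Comparison

variable {E : Type*} [NormedAddCommGroup E] [NormedSpace ℂ E] [FiniteDimensional ℂ E]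
  {M : Type*} [TopologicalSpace M] [ChartedSpace E M] [IsManifold 𝓘(ℂ, E) ω M]

variable {g : Metric E M} {D N : Connection E M}

theorem metric_self_eq_zero (g : Metric E M) {x : M} {a : TangentSpace 𝓘(ℝ, E) x}
    (h : g.inner x a a = 0) : a = 0 := by
  by_contra hne
  exact (g.pos x a hne).ne' h

theorem constField_J_J {x y : M} (hy : y ∈ (chartAt E x).source) (v : TangentSpace 𝓘(ℝ, E) x) :
    constField (J x (J x v)) y = -constField v y := by
  rw [← J_constField hy, ← J_constField hy, J_J]

/-- Both sides are half the derivative of |X|² along X. The identity is needed on a neighbourhood of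
x, because the curvature differentiates it once more. -/
theorem inner_cov_J_self_J (hD : IsLeviCivita g D) (hN : IsChern g N) (hg : IsHermitian g)
    {x y : M} (hy : y ∈ (chartAt E x).source) (u : TangentSpace 𝓘(ℝ, E) x) :
    g.inner y (D (constField u) y (constField (J x u) y)) (constField (J x u) y) =
      g.inner y (N (constField u) y (constField (J x u) y)) (constField (J x u) y) := by
  have h1 := hD.koszul hy (J x u) u (J x u)
  have h2 := hN.inner_cov_constField hg hy (J x u) u (J x u)
  rw [metricCoeff_symm g (J x u) u, mvfderiv_metricCoeff_J_J hg hy] at h1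
  rw [mvfderiv_metricCoeff_self_J hg hy, mvfderiv_metricCoeff_J_right hg hy,
    mvfderiv_metricCoeff_J_J hg hy, constField_J_J hy, map_neg] at h2
  linarith

/-- Both sides are minus half the derivative of |X|² along JX. -/
theorem inner_cov_self_self_J (hD : IsLeviCivita g D) (hN : IsChern g N) (hg : IsHermitian g)
    {x y : M} (hy : y ∈ (chartAt E x).source) (u : TangentSpace 𝓘(ℝ, E) x) :
    g.inner y (D (constField u) y (constField u y)) (constField (J x u) y) =
      g.inner y (N (constField u) y (constField u y)) (constField (J x u) y) := by
  have h1 := hD.koszul hy u u (J x u)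
  have h2 := hN.inner_cov_constField hg hy u u (J x u)
  rw [mvfderiv_metricCoeff_self_J hg hy] at h1
  rw [mvfderiv_metricCoeff_self_J hg hy, mvfderiv_metricCoeff_J_right hg hy,
    mvfderiv_metricCoeff_J_J hg hy] at h2
  linarith

/-- The Levi-Civita derivative `D_u (J X)` is `J (N_u X)`. -/
theorem leviCivita_cov_constField_J (hD : IsLeviCivita g D) (hN : IsChern g N)
    (hg : IsHermitian g) {x : M} (u : TangentSpace 𝓘(ℝ, E) x) :
    D (constField (J x u)) x u = J x (N (constField u) x u) := by
  have hx := mem_chart_source E x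
  refine metric_ext g fun w ↦ ?_
  have h1 := hD.koszul hx u (J x u) w
  have h2 := hN.inner_cov_constField hg hx u u (J x w)
  -- Since ⟨X, JX⟩ = 0, one Koszul term disappears. The other two are those of -2⟨N_u X, Jw⟩.
  rw [mvfderiv_metricCoeff_self_J hg hx] at h1
  rw [mvfderiv_metricCoeff_J_right hg hx, mvfderiv_metricCoeff_J_right hg hx u (J x w),
    mvfderiv_metricCoeff_J_J hg hx] at h2
  simp only [constField_self] at h1 h2
  rw [hg.inner_J_left]
  linarith

/-- In the difference of the two Koszul formulas the derivatives of |X|² and |JX|² along w cancel,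
and what remains is the Chern formula. -/
theorem leviCivita_cov_constField_sub (hD : IsLeviCivita g D) (hN : IsChern g N)
    (hg : IsHermitian g) {x : M} (u : TangentSpace 𝓘(ℝ, E) x) :
    D (constField u) x u - D (constField (J x u)) x (J x u) = (2 : ℝ) • N (constField u) x u := by
  have hx := mem_chart_source E x
  refine metric_ext g fun w ↦ ?_
  have h1 := hD.koszul hx u u w
  have h2 := hD.koszul hx (J x u) (J x u) w
  have h3 := hN.inner_cov_constField hg hx u u w
  rw [mvfderiv_metricCoeff_J_J hg hx] at h2
  rw [mvfderiv_metricCoeff_J_right hg hx] at h3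
  simp only [constField_self] at h1 h2 h3
  simp only [map_sub, map_smul, sub_apply, smul_apply, smul_eq_mul]
  linarith

/-- If the holomorphic sectional curvatures of the two connections agree, then `D_u X = N_u X` for
the constant field `X` with value `u`. -/
theorem leviCivita_eq_chern_self (hD : IsLeviCivita g D) (hN : IsChern g N) (hg : IsHermitian g)
    {x : M} (u : TangentSpace 𝓘(ℝ, E) x)
    (hR : curvature D (constField u) (constField (J x u)) (constField u) x =
      curvature N (constField u) (constField (J x u)) (constField u) x) :
    D (constField u) x u = N (constField u) x u := by
  have hx := mem_chart_source E x
  have h1 := hD.metric.inner_curvature (x := x) hD.isDiffAt_cov_constField u (J x u) u (J x u)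
  have h2 := hN.metric.inner_curvature (x := x) (hN.isDiffAt_cov_constField hg) u (J x u) u (J x u)
  have e1 := mvfderiv_real_congr (E := E) (Filter.eventuallyEq_of_mem (source_mem (E := E) x)
    fun y hy ↦ inner_cov_J_self_J hD hN hg hy u)
  have e2 := mvfderiv_real_congr (E := E) (Filter.eventuallyEq_of_mem (source_mem (E := E) x)
    fun y hy ↦ inner_cov_self_self_J hD hN hg hy u)
  -- The second-order terms on the two sides are now identical.
  rw [hR, h2, e1, e2] at h1
  have c1 := leviCivita_cov_constField_J hD hN hg u
  have c2 := leviCivita_cov_constField_sub hD hN hg u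
  have c3 := hD.cov_constField_comm hx (J x u) u
  rw [constField_self, constField_self, c1] at c3
  rw [sub_eq_iff_eq_add, ← sub_eq_iff_eq_add'] at c2
  rw [hN.cov_constField_J hx, hN.cov_constField_J hx, hN.cov_constField_apply_J hx, c1, c3, ← c2,
    J_J, hg x] at h1
  -- With a = D_u X and b = N_u X, the quadratic terms are |a|² - 2⟨a, b⟩ - |b|² for D and -2|b|²
  -- for N; their difference is |a - b|².
  refine sub_eq_zero.1 (metric_self_eq_zero g ?_)
  simp only [map_sub, map_neg, map_smul, sub_apply, neg_apply, smul_apply, smul_eq_mul] at h1 ⊢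
  rw [g.symm x (N (constField u) x u) (D (constField u) x u)]
  linarith

theorem torsion_apply_constField (N : Connection E M) {x : M}
    (u v : TangentSpace 𝓘(ℝ, E) x) :
    N.torsion x u v = N (constField v) x u - N (constField u) x v := by
  have : CompleteSpace E := FiniteDimensional.complete ℂ E
  have hx := mem_chart_source E x
  have := N.torsion_apply (isDiffAt_constField hx u) (isDiffAt_constField hx v)
  rwa [mlieBracket_constField hx, constField_self, constField_self, sub_zero] at this

/-- For holomorphic fields ∇_{Ju} = J ∇_u, and ∇J = 0, so both terms of the torsion are complex
linear in u. -/
theorem IsChern.torsion_J_left (hN : IsChern g N) {x : M} (u v : TangentSpace 𝓘(ℝ, E) x) :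
    N.torsion x (J x u) v = J x (N.torsion x u v) := by
  have hx := mem_chart_source E x
  rw [torsion_apply_constField, torsion_apply_constField, hN.cov_constField_J hx,
    hN.cov_constField_apply_J hx, map_sub]

theorem IsChern.torsion_J_right (hN : IsChern g N) {x : M} (u v : TangentSpace 𝓘(ℝ, E) x) :
    N.torsion x u (J x v) = J x (N.torsion x u v) := by
  rw [CovariantDerivative.torsion_antisymm, hN.torsion_J_left, ← map_neg,
    ← CovariantDerivative.torsion_antisymm]

/-- Expand 2⟨D_u X, w⟩ = 2 u⟨X, W⟩ - w⟨X, X⟩ by compatibility of N. The hypothesis cancels ⟨D_u X,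
w⟩, and what is left is the torsion. -/
theorem inner_chern_torsion_self (hD : IsLeviCivita g D) (hN : IsChern g N)
    {x : M} (u w : TangentSpace 𝓘(ℝ, E) x)
    (h : D (constField u) x u = N (constField u) x u) :
    g.inner x (N.torsion x w u) u = 0 := by
  have hx := mem_chart_source E x
  have h1 := hD.koszul hx u u w
  have h2 := hN.metric.mvfderiv_metricCoeff hx u w u
  have h3 := hN.metric.mvfderiv_metricCoeff hx u u w
  simp only [constField_self, h] at h1 h2 h3
  rw [g.symm x u] at h2 h3
  rw [torsion_apply_constField, map_sub, sub_apply]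
  linarith

/-- A bilinear map which is complex linear in both arguments vanishes as soon as
`⟪T(w, u), u⟫ = 0` for all `u` and `w`. -/
theorem IsChern.torsion_eq_zero (hN : IsChern g N) (hg : IsHermitian g)
    (h : ∀ (x : M) (u w : TangentSpace 𝓘(ℝ, E) x), g.inner x (N.torsion x w u) u = 0) :
    N.torsion = 0 := by
  have skew : ∀ (x : M) (w u v : TangentSpace 𝓘(ℝ, E) x),
      g.inner x (N.torsion x w u) v = -g.inner x (N.torsion x w v) u := by
    intro x w u v
    have h1 := h x (u + v) w
    simp only [map_add, add_apply, h] at h1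
    linarith
  have skewJ : ∀ (x : M) (w u v : TangentSpace 𝓘(ℝ, E) x),
      g.inner x (N.torsion x w u) (J x v) = -g.inner x (N.torsion x w v) (J x u) := by
    intro x w u v
    -- Replacing w by Jw puts a J on the torsion, which then crosses the inner product.
    have h1 := skew x (J x w) u v
    rw [hN.torsion_J_left, hN.torsion_J_left, hg.inner_J_left, hg.inner_J_left] at h1
    linarith
  funext x
  ext w u
  refine metric_ext g fun v ↦ ?_
  -- This makes ⟨T(w, u), v⟩ symmetric in u and v, whereas `skew` makes it antisymmetric.
  have h1 := skewJ x w u (J x v)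
  rw [J_J, hN.torsion_J_right, hg x, map_neg, skew x w v u] at h1
  simp only [Pi.zero_apply, zero_apply, map_zero]
  linarith

/-- The exterior derivative of the fundamental form vanishes when the Chern connection is
torsion-free. -/
theorem IsChern.isKahler_of_isLeviCivita (hN : IsChern g N) (hg : IsHermitian g)
    (hT : IsLeviCivita g N) : IsKahler g := by
  intro x X Y Z hX hY hZ
  have key : ∀ {A B : VField E M}, IsDiffAt A x → IsDiffAt B x → ∀ u,
      mvfderiv 𝓘(ℝ, E) (fun y ↦ fundamentalForm g y (A y) (B y)) x u =
        fundamentalForm g x (N A x u) (B x) + fundamentalForm g x (A x) (N B x u) := by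
    intro A B hA hB u
    have := hN.metric x _ _ hA.J hB u
    rwa [hN.map_J x A hA] at this
  have br : ∀ {A B : VField E M}, IsDiffAt A x → IsDiffAt B x →
      VectorField.mlieBracket 𝓘(ℝ, E) A B x = N B x (A x) - N A x (B x) := fun hA hB ↦
    ((CovariantDerivative.torsion_eq_zero_iff _).1 hT.torsion hA hB).symm
  have anti : ∀ a b : TangentSpace 𝓘(ℝ, E) x, fundamentalForm g x a b = -fundamentalForm g x b a :=
    fun a b ↦ by rw [fundamentalForm, hg.inner_J_left, g.symm, fundamentalForm]
  have sub : ∀ a b c : TangentSpace 𝓘(ℝ, E) x, fundamentalForm g x (a - b) c =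
      fundamentalForm g x a c - fundamentalForm g x b c :=
    fun a b c ↦ by simp only [fundamentalForm, map_sub, sub_apply]
  have hX := hX.isDiffAt
  have hY := hY.isDiffAt
  have hZ := hZ.isDiffAt
  -- The six terms from N ω = 0 cancel the six from the torsion-free brackets, by antisymmetry of ω.
  rw [dFundamentalForm, key hY hZ, key hZ hX, key hX hY, br hX hY, br hY hZ, br hZ hX, sub, sub,
    sub, anti (Y x), anti (Z x), anti (X x)]
  ring

end Comparison

end HermitianGeometry

theorem theorem1 {E : Type*} [NormedAddCommGroup E] [NormedSpace ℂ E] [FiniteDimensional ℂ E]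
    {M : Type*} [TopologicalSpace M] [ChartedSpace E M] [IsManifold 𝓘(ℂ, E) ω M]
    (g : HermitianGeometry.Metric E M) (hg : HermitianGeometry.IsHermitian g)
    (hR : ∀ (x : M) (X Y Z : HermitianGeometry.VField E M),
      HermitianGeometry.IsSmoothAt X x → HermitianGeometry.IsSmoothAt Y x →
      HermitianGeometry.IsSmoothAt Z x →
      HermitianGeometry.curvature (HermitianGeometry.leviCivita g) X Y Z x =
        HermitianGeometry.curvature (HermitianGeometry.chern g hg) X Y Z x) :
    HermitianGeometry.IsKahler g ∧
      ∀ (x : M) (Z : HermitianGeometry.VField E M), HermitianGeometry.IsDiffAt Z x →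
        HermitianGeometry.leviCivita g Z x = HermitianGeometry.chern g hg Z x := by
  have hD := HermitianGeometry.isLeviCivita_leviCivita g
  have hN := HermitianGeometry.isChern_chern g hg
  -- The curvature hypothesis enters only here, on constant fields with values u, Ju, u at the
  -- centre of their chart.
  have hT : HermitianGeometry.IsLeviCivita g (HermitianGeometry.chern g hg) := by
    refine ⟨hN.metric, hN.torsion_eq_zero hg fun x u w ↦
      HermitianGeometry.inner_chern_torsion_self hD hN u w
      (HermitianGeometry.leviCivita_eq_chern_self hD hN hg u (hR x _ _ _ ?_ ?_ ?_))⟩ <;>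
    exact HermitianGeometry.isSmoothAt_constField (mem_chart_source E x) _
  exact ⟨hN.isKahler_of_isLeviCivita hg hT, fun x Z hZ ↦ hD.unique hT hZ⟩
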